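/- Let $L$ be a finite geometric lattice with bottom $\hat 0$ and top $\hat 1$. Let $\mathcal G\subseteq L\setminus\{\hat 0\}$ be a building set of $L$: for every $X\in L$, the join map $\prod_{F}[\hat 0,F]\to[\hat 0,X]$, with $F$ running over the maximal elements of $\mathcal G\cap[\hat 0,X]$, is an isomorphism of posets. Assume that $(L,\mathcal G)$ is supersolvable, witnessed by a chosen maximal chain $\omega$ of $L$: every element of $\omega$ is modular and lies in $\mathcal G\cup\{\hat 0\}$, and $M\wedge G\in\mathcal G\cup\{\hat 0\}$ for all $M\in\omega$, $G\in\mathcal G$. For $G\in L$ with $G\neq\hat 0$ let $d(G)$ be the largest element different from $G$ of the chain $\{M\wedge G : M\in\omega\}$, let $d(\hat 0)=\hat 0$, and let $d^k$ be the $k$-th iterate of $d$ ($k\ge 0$, $d^0(G)=G$). The elements $d^k(G)$ are the initial segments of $G$. Fix a total order on the atoms of $L$ such that $H$ precedes $H'$ whenever, for some $k$, $H\le d^k(\hat 1)$ and $H'\not\le d^k(\hat 1)$. For $G,G'\in\mathcal G$ write $G\vartriangleleft G'$ if the word formed by the atoms below $G$, written in increasing order, is strictly smaller in the lexicographic order than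 the corresponding word of $G'$ (a proper prefix of a word being smaller than the word). Let $I\subset\mathbb Z[h_G : G\in\mathcal G]$ be the ideal generated by $h_H$ for all atoms $H$ of $L$ and by $\prod_{G'\in\mathcal A}(h_G-h_{G'})$ for all $G\in\mathcal G$ and all antichains $\mathcal A\subseteq\mathcal G$ with $\bigvee\mathcal A=G$, so that the Feichtner–Yuzvinsky ring is $\mathrm{FY}(L,\mathcal G)=\mathbb Z[h_G : G\in\mathcal G]/I$. Fix any monomial order on $\mathbb Z[h_G : G\in\mathcal G]$ such that $h_G<h_{G'}$ whenever $G\vartriangleleft G'$. A monomial is normal if it is not divisible by the leading monomial of any nonzero element of $I$. Let $G_1\vartriangleleft G_2$ be elements of $\mathcal G$, neither of them an atom of $L$, and let $G=G_1\vee G_2$. Then the monomial $h_{G_1}h_{G_2}$ is normal if and only if one of the following holds: 1. $G\notin\mathcal G$; 2. $G\in\mathcal G$, $G_2=G$, and $G_1$ is an initial segment of $G$; 3. $G\in\mathcal G$, $G_2\not\ge G_1$, $G_2$ is not covered by $G$, and $G_1=d^k(G)$, where $k$ is the maximal integer $k\ge 0$ with $d^k(G)\vee G_2=G$. -/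

import Mathlib

namespace BuiltLattice

open MvPolynomial

/-! A geometric lattice is a finite lattice which is atomistic (`IsAtomistic`) and semimodular
(`IsUpperModularLattice`). Maximal chains are terms of Mathlib's type `Flag L`. -/

section Combinatorics

variable {L : Type*} [Lattice L] [BoundedOrder L]

/-- The factors of `X` in `𝒢`: the maximal elements of `𝒢 ∩ [⊥, X]`. -/
def factors (𝒢 : Set L) (X : L) : Set L :=
  {F | Maximal (fun F => F ∈ 𝒢 ∧ F ≤ X) F}

/-- `𝒢` is a building set: it does not contain `⊥` and, for every `X`, taking joins is an
isomorphism of posets from the product of the intervals `[⊥, F]`, over the factors `F` of `X`,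
to the interval `[⊥, X]`. -/
def IsBuildingSet (𝒢 : Set L) : Prop :=
  ⊥ ∉ 𝒢 ∧ ∀ X : L, ∃ e : (∀ F : factors 𝒢 X, Set.Iic (F : L)) ≃o Set.Iic X,
    ∀ p : ∀ F : factors 𝒢 X, Set.Iic (F : L),
      IsLUB (Set.range fun F => (p F : L)) (e p : L)

/-- The pair `(X, Y)` is modular. -/
def IsModularPair (X Y : L) : Prop :=
  ∀ Z ≤ Y, Z ⊔ (X ⊓ Y) = (Z ⊔ X) ⊓ Y

/-- The element `X` is modular. -/
def IsModularElement (X : L) : Prop :=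
  ∀ Y : L, IsModularPair X Y ∧ IsModularPair Y X

/-- The maximal chain `ω` witnesses that the built lattice `(L, 𝒢)` is supersolvable: its elements
are modular and, apart from `⊥`, lie in `𝒢`, and meeting with them preserves `𝒢 ∪ {⊥}`. -/
structure IsSupersolvableChain (𝒢 : Set L) (ω : Flag L) : Prop where
  modular : ∀ M ∈ ω, IsModularElement M
  mem : ∀ M ∈ ω, M ∈ 𝒢 ∪ {⊥}
  inf_mem : ∀ M ∈ ω, ∀ G ∈ 𝒢, M ⊓ G ∈ 𝒢 ∪ {⊥}

variable [Fintype L]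

open Classical in
/-- `d ω G` is the coatom of the chain `{M ⊓ G | M ∈ ω}` induced by `ω` on `[⊥, G]`, that is, the
largest element of this chain different from `G`. By convention `d ω ⊥ = ⊥`. -/
noncomputable def d (ω : Flag L) (G : L) : L :=
  (Finset.univ.filter fun Y : L => Y < G ∧ ∃ M ∈ ω, Y = M ⊓ G).sup id

/-- `G'` is an initial segment of `G`: it is an iterate `d^k(G)`. -/
def IsInitialSegment (ω : Flag L) (G' G : L) : Prop :=
  ∃ k : ℕ, G' = (d ω)^[k] G

/-- The total order `r` on atoms is compatible with `ω`: if `a` is below some `d^k(⊤)` and `b`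
is not, then `a` comes before `b`. -/
def IsCompatible (ω : Flag L) (r : {a : L // IsAtom a} → {a : L // IsAtom a} → Prop) : Prop :=
  ∀ a b : {a : L // IsAtom a},
    (∃ k : ℕ, (a : L) ≤ (d ω)^[k] ⊤ ∧ ¬ (b : L) ≤ (d ω)^[k] ⊤) → r a b

open Classical in
/-- The word whose letters are the atoms below `G`, written in increasing order for `r`. -/
noncomputable def word (r : {a : L // IsAtom a} → {a : L // IsAtom a} → Prop)
    [IsLinearOrder {a : L // IsAtom a} r] (G : L) : List {a : L // IsAtom a} :=
  (Finset.univ.filter fun a : {a : L // IsAtom a} => (a : L) ≤ G).sort r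

/-- The strict order `G ◁ G'`: the word of `G` is lexicographically smaller than that of `G'`. -/
def WordLT (r : {a : L // IsAtom a} → {a : L // IsAtom a} → Prop)
    [IsLinearOrder {a : L // IsAtom a} r] (G G' : L) : Prop :=
  List.Lex (fun a b => r a b ∧ a ≠ b) (word r G) (word r G')

end Combinatorics

section Algebra

variable {L : Type*} [Lattice L] [BoundedOrder L]

/-- The ideal of relations of the Feichtner–Yuzvinsky ring `ℤ[h_G, G ∈ 𝒢] / I` in its
presentation by the generators `h_G`. -/
noncomputable def wonderfulIdeal (𝒢 : Set L) : Ideal (MvPolynomial 𝒢 ℤ) :=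
  Ideal.span
    ({f | ∃ H : 𝒢, IsAtom (H : L) ∧ f = X H} ∪
     {f | ∃ (G : 𝒢) (A : Finset 𝒢), IsAntichain (· ≤ ·) (A : Set 𝒢) ∧
        A.sup (fun G' : 𝒢 => (G' : L)) = (G : L) ∧ f = ∏ G' ∈ A, (X G - X G')})

/-- The monomial with exponent `e` is normal with respect to the ideal `I` and the monomial
order `m`: it is not divisible by the leading monomial of a nonzero element of `I`. -/
def IsNormalMonomial {σ : Type*} (m : MonomialOrder σ) (I : Ideal (MvPolynomial σ ℤ))
    (e : σ →₀ ℕ) : Prop :=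
  ∀ f ∈ I, f ≠ 0 → ¬ m.degree f ≤ e

end Algebra

end BuiltLattice

/-! Inside `[⊥, G]` the order is governed by the initial segments of `G`: they precede `G`, and
every other element of `𝒢` below `G` comes after it (`wordLT_of_isInitialSegment`,
`isInitialSegment_or_wordLT`). This rests on modularity of `ω`, which makes the iterates of `d`
descend by covers and equal meets `M ⊓ G`.

Non-normal pairs are leading monomials of explicit products in the ideal: a quadratic relation, the
difference of two with a common factor (`sub_mul_sub_mem_wonderfulIdeal`), or such a difference in
which one variable is an atom and drops out (`X_mul_sub_mem_wonderfulIdeal`).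

Normality is proved by duality. Sum the coefficients over a set of quadratic monomials, chosen so
that the sum vanishes on the ideal and the given monomial is least in the set. An element of the
ideal led by that monomial would then have zero leading coefficient (`isNormalMonomial_of_pair`).
The sets consist of pairs with a fixed join, since all four monomials of `(X G - X B) * (X G - X C)`
have join `G`. -/

namespace BuiltLattice

/-! ### Lexicographic comparison of sorted lists -/

section Lex

variable {α : Type*} {r : α → α → Prop}

/-- A sublist of a sorted list which omits a letter preceding one of its own letters is
lexicographically larger. -/
theorem lex_of_sublist_of_not_mem [Std.Antisymm r] {l₁ l₂ : List α} (h : l₂.Sublist l₁)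
    (hr : l₁.Pairwise r) (hn : l₁.Nodup) {x y : α} (hx : x ∈ l₁) (hx' : x ∉ l₂) (hy : y ∈ l₂)
    (hxy : r x y) : List.Lex (fun a b => r a b ∧ a ≠ b) l₁ l₂ := by
  induction h with
  | slnil => simp at hx
  | @cons l₂ l₁ a h ih =>
    rw [List.pairwise_cons] at hr
    rw [List.nodup_cons] at hn
    cases l₂ with
    | nil => simp at hy
    | cons b l =>
      have hb : b ∈ l₁ := h.subset (by simp)
      exact .rel ⟨hr.1 b hb, fun e => hn.1 (e ▸ hb)⟩
  | @cons_cons l₂ l₁ a h ih =>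
    rw [List.pairwise_cons] at hr
    rw [List.nodup_cons] at hn
    simp only [List.mem_cons, not_or] at hx hx' hy
    have hx1 : x ∈ l₁ := hx.resolve_left hx'.1
    refine .cons (ih hr.2 hn.2 hx1 hx'.2 (hy.resolve_left ?_))
    rintro rfl
    exact hx'.1 (antisymm_of r hxy (hr.1 x hx1))

/-- A proper sublist of a sorted list all of whose letters precede the omitted ones is
lexicographically smaller. -/
theorem lex_of_sublist_of_forall [Std.Antisymm r] {l₁ l₂ : List α} (h : l₂.Sublist l₁)
    (hr : l₁.Pairwise r) (hn : l₁.Nodup) (hne : l₂ ≠ l₁)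
    (hlt : ∀ x ∈ l₁, x ∉ l₂ → ∀ y ∈ l₂, r y x) :
    List.Lex (fun a b => r a b ∧ a ≠ b) l₂ l₁ := by
  induction h with
  | slnil => simp at hne
  | @cons l₂ l₁ a h ih =>
    rw [List.pairwise_cons] at hr
    rw [List.nodup_cons] at hn
    cases l₂ with
    | nil => exact .nil
    | cons b l =>
      have hb : b ∈ l₁ := h.subset (by simp)
      have := antisymm_of r (hr.1 b hb) (hlt a (by simp) (fun ha => hn.1 (h.subset ha)) b (by simp))
      exact absurd (this ▸ hb) hn.1
  | @cons_cons l₂ l₁ a h ih =>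
    rw [List.pairwise_cons] at hr
    rw [List.nodup_cons] at hn
    refine .cons (ih hr.2 hn.2 (fun e => hne (by rw [e])) fun x hx hx' y hy => ?_)
    refine hlt x (by simp [hx]) ?_ y (by simp [hy])
    simp only [List.mem_cons, not_or]
    exact ⟨fun e => hn.1 (e ▸ hx), hx'⟩

end Lex

theorem exists_atom_not_le {L : Type*} [Lattice L] [BoundedOrder L] [IsAtomistic L]
    {A B : L} (h : ¬ A ≤ B) :
    ∃ a : {a : L // IsAtom a}, (a : L) ≤ A ∧ ¬ (a : L) ≤ B := by
  by_contra! hc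
  exact h (le_iff_atom_le_imp.2 fun c hc1 hc2 => hc ⟨c, hc1⟩ hc2)

/-! ### The chain of initial segments -/

section Chain

variable {L : Type*} [Lattice L] [BoundedOrder L] [Fintype L]

/-- Take `M` largest in `ω` not above `X`, and `M'` its successor. For `z` strictly between `M ⊓ X`
and `X`, the join `z ⊔ M` lies between `M` and `M'`, so it belongs to the maximal chain and is one
of them. Modularity, `(z ⊔ M) ⊓ X = z`, rules out both. -/
theorem exists_flag_inf_covBy (ω : Flag L) (hω : ∀ M ∈ ω, IsModularElement M) {X : L}
    (hX : X ≠ ⊥) :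
    ∃ M ∈ ω, M ⊓ X ⋖ X ∧ ∀ M' ∈ ω, ¬ X ≤ M' → M' ≤ M := by
  obtain ⟨M, ⟨hM, hXM⟩, hmax⟩ := (Set.toFinite {M | M ∈ ω ∧ ¬ X ≤ M}).exists_maximal
    ⟨⊥, ω.bot_mem, by simpa using hX⟩
  have hmax' : ∀ M' ∈ ω, ¬ X ≤ M' → M' ≤ M := fun M' hM' h =>
    (ω.le_or_le hM' hM).elim id fun h' => hmax ⟨hM', h⟩ h'
  obtain ⟨M', ⟨hM', hMM'⟩, hmin⟩ := (Set.toFinite {M' | M' ∈ ω ∧ M < M'}).exists_minimal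
    ⟨⊤, ω.top_mem, lt_top_iff_ne_top.2 fun h => hXM (h ▸ le_top)⟩
  have hXM' : X ≤ M' := by
    by_contra h
    exact (hmax' M' hM' h).not_gt hMM'
  refine ⟨M, hM, ⟨inf_lt_right.2 hXM, fun z hz hzX => ?_⟩, hmax'⟩
  have hzw : (z ⊔ M) ⊓ X = z := by
    rw [← ((hω M hM) X).1 z hzX.le, sup_eq_left.2 hz.le]
  have hmem : z ⊔ M ∈ ω := by
    refine Flag.mem_iff_forall_le_or_ge.2 fun N hN => ?_
    rcases ω.le_or_le hN hM with h | h
    · exact Or.inr (h.trans le_sup_right)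
    · rcases h.eq_or_lt with rfl | h
      · exact Or.inr le_sup_right
      · left
        have hN' : M' ≤ N := (ω.le_or_le hN hM').elim (fun h' => hmin ⟨hN, h⟩ h') id
        exact sup_le ((hzX.le.trans hXM').trans hN') (hMM'.le.trans hN')
  rcases (le_sup_right : M ≤ z ⊔ M).eq_or_lt with h | h
  · exact hz.not_ge (le_inf (h ▸ le_sup_left) hzX.le)
  · have hN' : M' ≤ z ⊔ M := (ω.le_or_le hmem hM').elim (fun h' => hmin ⟨hmem, h⟩ h') id
    rw [inf_eq_right.2 (hXM'.trans hN')] at hzw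
    exact hzX.ne hzw.symm

theorem exists_d_eq (ω : Flag L) (hω : ∀ M ∈ ω, IsModularElement M) {X : L} (hX : X ≠ ⊥) :
    (∃ M ∈ ω, d ω X = M ⊓ X) ∧ d ω X ⋖ X ∧ ∀ M' ∈ ω, ¬ X ≤ M' → M' ⊓ X ≤ d ω X := by
  obtain ⟨M, hM, hc, hmax⟩ := exists_flag_inf_covBy ω hω hX
  have hd : d ω X = M ⊓ X := by
    apply le_antisymm
    · refine Finset.sup_le fun Y hY => ?_
      simp only [Finset.mem_filter, Finset.mem_univ, true_and] at hY
      obtain ⟨hYX, M', hM', rfl⟩ := hY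
      exact inf_le_inf_right _ (hmax M' hM' (inf_lt_right.1 hYX))
    · refine Finset.le_sup (f := id) ?_
      simp only [Finset.mem_filter, Finset.mem_univ, true_and]
      exact ⟨hc.lt, M, hM, rfl⟩
  refine ⟨⟨M, hM, hd⟩, hd ▸ hc, fun M' hM' h => ?_⟩
  rw [hd]
  exact inf_le_inf_right _ (hmax M' hM' h)

@[simp] theorem d_bot (ω : Flag L) : d ω ⊥ = ⊥ := by
  simp [d]

theorem d_le (ω : Flag L) (X : L) : d ω X ≤ X := by
  refine Finset.sup_le fun Y hY => ?_
  simp only [Finset.mem_filter, Finset.mem_univ, true_and] at hY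
  exact hY.1.le

theorem antitone_iterate_d (ω : Flag L) (X : L) : Antitone fun k => (d ω)^[k] X := by
  refine antitone_nat_of_succ_le fun k => ?_
  simp only [Function.iterate_succ_apply']
  exact d_le ω _

theorem iterate_d_le (ω : Flag L) (X : L) (k : ℕ) : (d ω)^[k] X ≤ X :=
  antitone_iterate_d ω X (Nat.zero_le k)

theorem exists_iterate_d_eq (ω : Flag L) (hω : ∀ M ∈ ω, IsModularElement M) (X : L) (k : ℕ) :
    ∃ M ∈ ω, (d ω)^[k] X = M ⊓ X := by
  induction k with
  | zero => exact ⟨⊤, ω.top_mem, by simp⟩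
  | succ k ih =>
    obtain ⟨M, hM, h⟩ := ih
    rw [Function.iterate_succ_apply', h]
    by_cases hb : M ⊓ X = ⊥
    · exact ⟨M, hM, by rw [hb, d_bot]⟩
    · obtain ⟨⟨M', hM', h'⟩, -⟩ := exists_d_eq ω hω hb
      rw [h']
      -- `M' ⊓ M` is the smaller of two members of a chain, hence again in `ω`.
      rcases ω.le_or_le hM hM' with h1 | h1
      · exact ⟨M, hM, by rw [← inf_assoc, inf_eq_right.2 h1]⟩
      · exact ⟨M', hM', by rw [← inf_assoc, inf_eq_left.2 h1]⟩

/-- Locates the shortest initial segment containing `A`. The equality alternative is needed for `A =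
⊥`, where the iterates stabilise. -/
theorem exists_le_iterate_d (ω : Flag L) (hω : ∀ M ∈ ω, IsModularElement M) {A X : L}
    (h : A ≤ X) :
    ∃ k, A ≤ (d ω)^[k] X ∧ (A = (d ω)^[k] X ∨ ¬ A ≤ (d ω)^[k + 1] X) := by
  induction X using WellFoundedLT.induction with
  | _ X ih =>
    by_cases hA : A ≤ d ω X
    · by_cases hX : X = ⊥
      · subst hX
        exact ⟨0, h, Or.inl (le_bot_iff.1 h)⟩
      · obtain ⟨k, hk⟩ := ih (d ω X) (exists_d_eq ω hω hX).2.1.lt hA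
        exact ⟨k + 1, hk⟩
    · exact ⟨0, h, Or.inr hA⟩

theorem exists_eq_iterate_d_top (ω : Flag L) (hω : ∀ M ∈ ω, IsModularElement M) {M : L}
    (hM : M ∈ ω) : ∃ k, M = (d ω)^[k] ⊤ := by
  obtain ⟨k, hk, h⟩ := exists_le_iterate_d ω hω (le_top : M ≤ ⊤)
  refine ⟨k, h.elim id fun h => ?_⟩
  by_contra hne
  have hlt := lt_of_le_of_ne hk hne
  apply h
  rw [Function.iterate_succ_apply']
  have := (exists_d_eq ω hω hlt.ne_bot).2.2 M hM hlt.not_ge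
  rwa [inf_eq_left.2 hk] at this

theorem eq_or_eq_of_iterate_d_le (ω : Flag L) (hω : ∀ M ∈ ω, IsModularElement M) {A X : L}
    {k : ℕ} (h : A ≤ (d ω)^[k] X) (h' : (d ω)^[k + 1] X ≤ A) :
    A = (d ω)^[k] X ∨ A = (d ω)^[k + 1] X := by
  rw [Function.iterate_succ_apply'] at h' ⊢
  by_cases hb : (d ω)^[k] X = ⊥
  · left
    rw [hb] at h ⊢
    exact le_bot_iff.1 h
  · exact ((exists_d_eq ω hω hb).2.1.eq_or_eq h' h).symm

/-! ### Words of atoms and initial segments -/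

section Word

variable {r : {a : L // IsAtom a} → {a : L // IsAtom a} → Prop}

/-- Compatibility is stated for `⊤` only; it passes to `G` because `d^k(G) = M ⊓ G` with `M` an
iterate of `d` at `⊤`. -/
theorem rel_of_le_iterate_d {ω : Flag L} (hω : ∀ M ∈ ω, IsModularElement M)
    (hr : IsCompatible ω r) {G : L} {k : ℕ} {a b : {a : L // IsAtom a}}
    (ha : (a : L) ≤ (d ω)^[k] G) (hb : (b : L) ≤ G) (hb' : ¬ (b : L) ≤ (d ω)^[k] G) : r a b := by
  obtain ⟨M, hM, h⟩ := exists_iterate_d_eq ω hω G k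
  obtain ⟨j, rfl⟩ := exists_eq_iterate_d_top ω hω hM
  rw [h] at ha hb'
  exact hr a b ⟨j, ha.trans inf_le_left, fun h' => hb' (le_inf h' hb)⟩

variable [IsLinearOrder {a : L // IsAtom a} r]

@[simp] theorem mem_word {G : L} {a : {a : L // IsAtom a}} : a ∈ word r G ↔ (a : L) ≤ G := by
  simp [word]

open Classical in
theorem word_pairwise (G : L) : (word r G).Pairwise r := Finset.pairwise_sort _ _

open Classical in
theorem word_nodup (G : L) : (word r G).Nodup := Finset.sort_nodup _ _

theorem word_sublist {A G : L} (h : A ≤ G) : (word r A).Sublist (word r G) := by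
  refine List.sublist_of_subperm_of_pairwise (r := r) ?_ (word_pairwise A) (word_pairwise G)
  refine List.subperm_of_subset (word_nodup A) fun a ha => ?_
  rw [mem_word] at ha ⊢
  exact ha.trans h

variable [IsAtomistic L]

/-- An element of `[⊥, G]` which is not an initial segment of `G` is larger than `G`. -/
theorem isInitialSegment_or_wordLT {ω : Flag L} (hω : ∀ M ∈ ω, IsModularElement M)
    (hr : IsCompatible ω r) {A G : L} (h : A ≤ G) : IsInitialSegment ω A G ∨ WordLT r G A := by
  obtain ⟨k, hk, h1 | h1⟩ := exists_le_iterate_d ω hω h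
  · exact Or.inl ⟨k, h1⟩
  by_cases h2 : (d ω)^[k + 1] G ≤ A
  · rcases eq_or_eq_of_iterate_d_le ω hω hk h2 with h3 | h3
    · exact Or.inl ⟨k, h3⟩
    · exact absurd h3.le h1
  right
  -- `A` misses an atom `x` of `d^(k+1)(G)` but contains an atom `y` outside it, and `x` precedes
  -- `y`.
  obtain ⟨x, hx, hx'⟩ := exists_atom_not_le h2
  obtain ⟨y, hy, hy'⟩ := exists_atom_not_le h1
  exact lex_of_sublist_of_not_mem (word_sublist h) (word_pairwise G) (word_nodup G)
    (x := x) (y := y) (mem_word.2 (hx.trans (iterate_d_le ω G _))) (by simpa using hx')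
    (by simpa using hy) (rel_of_le_iterate_d hω hr hx (hy.trans h) hy')

theorem wordLT_of_isInitialSegment {ω : Flag L} (hω : ∀ M ∈ ω, IsModularElement M)
    (hr : IsCompatible ω r) {A G : L} (h : IsInitialSegment ω A G) (hne : A ≠ G) :
    WordLT r A G := by
  obtain ⟨k, rfl⟩ := h
  have hle := iterate_d_le ω G k
  refine lex_of_sublist_of_forall (word_sublist hle) (word_pairwise G) (word_nodup G) ?_ ?_
  · intro h
    refine hne (le_antisymm hle (le_iff_atom_le_imp.2 fun c hc hcG => ?_))
    have : (⟨c, hc⟩ : {a : L // IsAtom a}) ∈ word r G := mem_word.2 hcG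
    rw [← h] at this
    exact mem_word.1 this
  · intro x hx hx' y hy
    rw [mem_word] at hx hx' hy
    exact rel_of_le_iterate_d hω hr hy hx hx'

end Word

end Chain

open MvPolynomial

/-! ### Coefficient functionals -/

section Functional

variable {σ : Type*}

/-- The linear functional on polynomials which takes the value `φ e` at the monomial of
exponent `e`. -/
noncomputable def functional (φ : (σ →₀ ℕ) → ℤ) : MvPolynomial σ ℤ →ₗ[ℤ] ℤ :=
  (basisMonomials σ ℤ).constr ℤ φ

@[simp] theorem functional_monomial (φ : (σ →₀ ℕ) → ℤ) (e : σ →₀ ℕ) (c : ℤ) :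
    functional φ (monomial e c) = c * φ e := by
  have h : monomial e c = c • basisMonomials σ ℤ e := by
    rw [coe_basisMonomials, smul_monomial, smul_eq_mul, mul_one]
  rw [h, map_smul, functional, Module.Basis.constr_basis, smul_eq_mul]

theorem functional_eq_sum (φ : (σ →₀ ℕ) → ℤ) (f : MvPolynomial σ ℤ) :
    functional φ f = ∑ e ∈ f.support, f.coeff e * φ e := by
  exact (congrArg (functional φ) f.as_sum).trans (by simp only [map_sum, functional_monomial])

/-- The indicator function of the exponents of the monomials `x y` with `P x y`. -/
noncomputable def pairWeight (P : σ → σ → Prop) (e : σ →₀ ℕ) : ℤ :=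
  open Classical in
  if ∃ x y, P x y ∧ e = Finsupp.single x 1 + Finsupp.single y 1 then 1 else 0

theorem pairWeight_single_add_single {P : σ → σ → Prop} (hP : ∀ x y, P x y → P y x) (x y : σ)
    [Decidable (P x y)] :
    pairWeight P (Finsupp.single x 1 + Finsupp.single y 1) = if P x y then 1 else 0 := by
  unfold pairWeight
  congr 1
  refine propext ⟨?_, fun h => ⟨x, y, h, rfl⟩⟩
  rintro ⟨x', y', h, he⟩
  rw [Finsupp.single_add_single_eq_single_add_single one_ne_zero one_ne_zero] at he
  rcases he with ⟨rfl, rfl⟩ | ⟨-, rfl, rfl⟩ | ⟨h2, -⟩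
  · exact h
  · exact hP _ _ h
  · simp at h2

end Functional

/-! ### Functionals vanishing on the ideal, and the normality criterion -/

section Ideal

variable {L : Type*} [Lattice L] [BoundedOrder L] {𝒢 : Set L}

/-- A functional kills the ideal of relations if it kills the monomials which contain an atom, the
monomials of degree at least three, and the quadratic relations. -/
theorem functional_eq_zero_of_mem (h𝒢 : ⊥ ∉ 𝒢) (φ : (𝒢 →₀ ℕ) → ℤ)
    (hatom : ∀ e : 𝒢 →₀ ℕ, ∀ H : 𝒢, IsAtom (H : L) → e H ≠ 0 → φ e = 0)
    (hdeg : ∀ e : 𝒢 →₀ ℕ, 3 ≤ e.degree → φ e = 0)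
    (hrel : ∀ G B C : 𝒢, ¬ (B : L) ≤ C → ¬ (C : L) ≤ B → (B : L) ⊔ C = G →
      functional φ ((X G - X B) * (X G - X C)) = 0)
    {f : MvPolynomial 𝒢 ℤ} (hf : f ∈ wonderfulIdeal 𝒢) : functional φ f = 0 := by
  classical
  have hhom : ∀ (f : MvPolynomial 𝒢 ℤ) (n : ℕ), 3 ≤ n → f.IsHomogeneous n →
      functional φ f = 0 := by
    intro f n hn hf
    rw [functional_eq_sum]
    refine Finset.sum_eq_zero fun e he => ?_
    rw [hdeg e, mul_zero]
    have := hf (mem_support_iff.1 he)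
    rw [show Finsupp.weight 1 e = e.degree by rw [Finsupp.degree_eq_weight_one]; rfl] at this
    omega
  -- The functional is only `ℤ`-linear, so the induction must carry all polynomial multiples.
  suffices h : ∀ p, functional φ (p * f) = 0 by simpa using h 1
  unfold wonderfulIdeal at hf
  induction hf using Submodule.span_induction with
  | zero => simp
  | add f g _ _ hf hg => intro p; rw [mul_add, map_add, hf, hg, add_zero]
  | smul a f _ hf => intro p; rw [smul_eq_mul, ← mul_assoc, hf]
  | mem f hf =>
    intro p
    induction p using MvPolynomial.induction_on' with
    | add p q hp hq => rw [add_mul, map_add, hp, hq, add_zero]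
    | monomial e c =>
      rcases hf with ⟨H, hH, rfl⟩ | ⟨G, A, hA, hsup, rfl⟩
      · rw [X, monomial_mul, functional_monomial, hatom _ H hH (by simp), mul_zero]
      · have hprod : (∏ G' ∈ A, (X G - X G' : MvPolynomial 𝒢 ℤ)).IsHomogeneous A.card := by
          have := IsHomogeneous.prod A (fun G' => (X G - X G' : MvPolynomial 𝒢 ℤ)) (fun _ => 1)
            fun G' _ => (isHomogeneous_X ℤ G).sub (isHomogeneous_X ℤ G')
          simpa using this
        have hmul := (isHomogeneous_monomial (n := e.degree) c rfl).mul hprod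
        by_cases hn : 3 ≤ e.degree + A.card
        · exact hhom _ _ hn hmul
        -- In degree at most two, only a two-element antichain with constant multiplier gives a
        -- nonzero relation: the empty join is `⊥ ∉ 𝒢`, and a singleton gives the factor `X G - X
        -- G`.
        · have h0 : A.card ≠ 0 := by
            intro h0
            rw [Finset.card_eq_zero] at h0
            subst h0
            exact h𝒢 (by rw [Finset.sup_empty] at hsup; rw [hsup]; exact G.2)
          by_cases h1 : A.card = 1
          · obtain ⟨B, rfl⟩ := Finset.card_eq_one.1 h1
            rw [Finset.sup_singleton] at hsup
            rw [Finset.prod_singleton, Subtype.ext hsup, sub_self, mul_zero, map_zero]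
          · have h2 : A.card = 2 := by omega
            obtain ⟨B, C, hBC, rfl⟩ := Finset.card_eq_two.1 h2
            have he : e = 0 := by
              rw [← Finsupp.degree_eq_zero_iff]; omega
            rw [Finset.prod_pair hBC, he]
            rw [show (monomial (0 : 𝒢 →₀ ℕ)) c = MvPolynomial.C c from rfl, ← smul_eq_C_mul, map_smul,
              hrel G B C (hA (by simp) (by simp) hBC) (hA (by simp) (by simp) hBC.symm) ?_,
              smul_zero]
            rw [Finset.sup_insert, Finset.sup_singleton] at hsup
            exact hsup

theorem functional_quadratic {σ : Type*} (φ : (σ →₀ ℕ) → ℤ) (G B C : σ) :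
    functional φ ((X G - X B) * (X G - X C)) =
      φ (Finsupp.single G 1 + Finsupp.single G 1) - φ (Finsupp.single G 1 + Finsupp.single B 1)
        - φ (Finsupp.single G 1 + Finsupp.single C 1)
        + φ (Finsupp.single B 1 + Finsupp.single C 1) := by
  have h : ∀ x y : σ, functional φ (X x * X y) = φ (Finsupp.single x 1 + Finsupp.single y 1) := by
    intro x y
    rw [X, X, monomial_mul, functional_monomial]
    simp
  rw [show (X G - X B) * (X G - X C) = (X G * X G - X G * X B - X G * X C + X B * X C :
    MvPolynomial σ ℤ) by ring]
  simp only [map_add, map_sub, h]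

theorem coeff_zero_of_mem (h𝒢 : ⊥ ∉ 𝒢) {f : MvPolynomial 𝒢 ℤ} (hf : f ∈ wonderfulIdeal 𝒢)
    (e : 𝒢 →₀ ℕ) (he : e.degree ≤ 1) (hatom : ∀ H : 𝒢, IsAtom (H : L) → e H = 0) :
    f.coeff e = 0 := by
  classical
  have h := functional_eq_zero_of_mem h𝒢 (fun e' => if e' = e then 1 else 0) ?_ ?_ ?_ hf
  · rw [functional_eq_sum] at h
    simpa using h
  · intro e' H hH h
    rw [if_neg]
    rintro rfl
    exact h (hatom H hH)
  · intro e' h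
    rw [if_neg]
    rintro rfl
    omega
  · intro G B C _ _ _
    have : ∀ x y : 𝒢, Finsupp.single x 1 + Finsupp.single y 1 ≠ e := by
      rintro x y rfl
      simp at he
    rw [functional_quadratic]
    simp [this]

/-- A criterion for normality: the monomial `x y` is minimal in a set of monomials whose
coefficients have sum zero in all relations. -/
theorem isNormalMonomial_of_pair (h𝒢 : ⊥ ∉ 𝒢) (m : MonomialOrder 𝒢) (P : 𝒢 → 𝒢 → Prop)
    [DecidableRel P] (hsymm : ∀ x y, P x y → P y x) (hatom : ∀ x y, P x y → ¬ IsAtom (x : L))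
    (hrel : ∀ G B C : 𝒢, ¬ (B : L) ≤ C → ¬ (C : L) ≤ B → (B : L) ⊔ C = G →
      (if P G G then 1 else 0) - (if P G B then 1 else 0) - (if P G C then 1 else 0)
        + (if P B C then 1 else 0) = (0 : ℤ))
    {x y : 𝒢} (hxy : P x y)
    (hle : ∀ x' y', P x' y' → m.toSyn (Finsupp.single x 1 + Finsupp.single y 1) ≤
      m.toSyn (Finsupp.single x' 1 + Finsupp.single y' 1)) :
    IsNormalMonomial m (wonderfulIdeal 𝒢) (Finsupp.single x 1 + Finsupp.single y 1) := by
  intro f hf hf0 hdeg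
  have hlead := m.coeff_degree_ne_zero_iff.2 hf0
  have hsmall : ∀ H : 𝒢, IsAtom (H : L) → m.degree f H = 0 := by
    intro H hH
    have h := hdeg H
    have hx : x ≠ H := by rintro rfl; exact hatom _ _ hxy hH
    have hy : y ≠ H := by rintro rfl; exact hatom _ _ (hsymm _ _ hxy) hH
    simpa [hx, hy] using h
  have hd : 2 ≤ (m.degree f).degree := by
    by_contra h
    exact hlead (coeff_zero_of_mem h𝒢 hf _ (by omega) hsmall)
  have heq : m.degree f = Finsupp.single x 1 + Finsupp.single y 1 := by
    obtain ⟨c, hc⟩ := exists_add_of_le hdeg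
    have h := congrArg Finsupp.degree hc
    simp only [map_add, Finsupp.degree_single] at h
    have : c = 0 := by rw [← Finsupp.degree_eq_zero_iff]; omega
    rw [hc, this, add_zero]
  -- The other monomials of `f` are smaller than `x y`, hence carry weight zero; the functional
  -- reads off the leading coefficient.
  have h := functional_eq_zero_of_mem h𝒢 (pairWeight P) ?_ ?_ ?_ hf
  · rw [functional_eq_sum, Finset.sum_eq_single (m.degree f)] at h
    · rw [heq, pairWeight_single_add_single hsymm, if_pos hxy, mul_one, ← heq] at h
      exact hlead h
    · intro e he hne
      unfold pairWeight
      rw [if_neg, mul_zero]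
      rintro ⟨x', y', hP, rfl⟩
      have h1 := hle x' y' hP
      rw [← heq] at h1
      exact hne (m.toSyn.injective (le_antisymm (m.le_degree he) h1))
    · intro h
      exact absurd (m.degree_mem_support hf0) h
  · intro e H hH he
    unfold pairWeight
    rw [if_neg]
    rintro ⟨x', y', hP, rfl⟩
    have hx : x' ≠ H := by rintro rfl; exact hatom _ _ hP hH
    have hy : y' ≠ H := by rintro rfl; exact hatom _ _ (hsymm _ _ hP) hH
    simp [hx, hy] at he
  · intro e he
    unfold pairWeight
    rw [if_neg]
    rintro ⟨x', y', hP, rfl⟩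
    simp at he
  · intro G B C hBC hCB hG
    rw [functional_quadratic]
    simp only [pairWeight_single_add_single hsymm]
    exact hrel G B C hBC hCB hG

end Ideal

/-! ### Products in the ideal and their leading monomials -/

section Relations

variable {L : Type*} [Lattice L] [BoundedOrder L] {𝒢 : Set L}

theorem X_mem_wonderfulIdeal {H : 𝒢} (hH : IsAtom (H : L)) : X H ∈ wonderfulIdeal 𝒢 :=
  Ideal.subset_span (Or.inl ⟨H, hH, rfl⟩)

theorem mul_mem_wonderfulIdeal {G B C : 𝒢} (hBC : ¬ (B : L) ≤ C) (hCB : ¬ (C : L) ≤ B)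
    (hG : (B : L) ⊔ C = G) : (X G - X B) * (X G - X C) ∈ wonderfulIdeal 𝒢 := by
  classical
  have hne : B ≠ C := by rintro rfl; exact hBC le_rfl
  refine Ideal.subset_span (Or.inr ⟨G, {B, C}, ?_, ?_, ?_⟩)
  · rw [Finset.coe_pair, isAntichain_insert]
    refine ⟨by simp, ?_⟩
    rintro b hb -
    rw [Set.mem_singleton_iff] at hb
    subst hb
    exact ⟨hBC, hCB⟩
  · rw [Finset.sup_insert, Finset.sup_singleton]
    exact hG
  · rw [Finset.prod_pair hne]

/-- If the ideal contains a product of two polynomials with leading monomials `x` and `y`, then the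
monomial `x y` is not normal. -/
theorem not_isNormalMonomial_of_mul_mem {σ : Type*} (m : MonomialOrder σ)
    {I : Ideal (MvPolynomial σ ℤ)} {x y : σ} {p q : MvPolynomial σ ℤ}
    (hp : m.degree p = Finsupp.single x 1) (hq : m.degree q = Finsupp.single y 1)
    (h : p * q ∈ I) :
    ¬ IsNormalMonomial m I (Finsupp.single x 1 + Finsupp.single y 1) := by
  intro hn
  have hp0 : p ≠ 0 := m.ne_zero_of_degree_ne_zero (by rw [hp]; simp)
  have hq0 : q ≠ 0 := m.ne_zero_of_degree_ne_zero (by rw [hq]; simp)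
  refine hn _ h (mul_ne_zero hp0 hq0) ?_
  rw [m.degree_mul hp0 hq0, hp, hq]

theorem degree_X_sub_X {σ : Type*} (m : MonomialOrder σ) {x y : σ}
    (h : m.toSyn (Finsupp.single y 1) < m.toSyn (Finsupp.single x 1)) :
    m.degree (X x - X y : MvPolynomial σ ℤ) = Finsupp.single x 1 := by
  rw [m.degree_sub_of_lt, m.degree_X]
  rwa [m.degree_X, m.degree_X]

theorem degree_X_sub_X' {σ : Type*} (m : MonomialOrder σ) {x y : σ}
    (h : m.toSyn (Finsupp.single y 1) < m.toSyn (Finsupp.single x 1)) :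
    m.degree (X y - X x : MvPolynomial σ ℤ) = Finsupp.single x 1 := by
  rw [← neg_sub, m.degree_neg, degree_X_sub_X m h]

end Relations

/-! ### Atoms and covers in a semimodular lattice -/

section Atoms

variable {L : Type*} [Lattice L] [BoundedOrder L] [IsUpperModularLattice L]

theorem _root_.IsAtom.covBy_sup {H A : L} (hH : IsAtom H) (h : ¬ H ≤ A) : A ⋖ H ⊔ A := by
  refine covBy_sup_of_inf_covBy_left ?_
  rw [(hH.le_iff.1 inf_le_left).resolve_right fun h' => h (inf_eq_left.1 h')]
  exact hH.bot_covBy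

theorem not_isAtom_of_sup_eq {A H G : L} (hA : A < G) (hc : ¬ A ⋖ G) (h : H ⊔ A = G) :
    ¬ IsAtom H := fun hH =>
  hc (h ▸ hH.covBy_sup fun h' => hA.ne (by rwa [sup_eq_right.2 h'] at h))

/-- The join of two atoms covers only atoms. -/
theorem isAtom_of_covBy_sup [IsAtomic L] {H H' D : L} (hH : IsAtom H) (hH' : IsAtom H')
    (hD : D ⋖ H ⊔ H') (hD0 : D ≠ ⊥) : IsAtom D := by
  by_contra hDa
  have hsup : ∀ K : L, IsAtom K → K < D → ∀ A, IsAtom A → A ⋖ H ⊔ H' → False := by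
    intro K hK hKD A hA hAc
    have hAD : ¬ A ≤ D := fun h =>
      hAc.2 (lt_of_le_of_ne h (by rintro rfl; exact hDa hA)) hD.lt
    have hKA : ¬ K ≤ A := fun h => hAD ((hA.le_iff.1 h).resolve_left hK.1 ▸ hKD.le)
    have h1 := hK.covBy_sup hKA
    have h2 : K ⊔ A = H ⊔ H' :=
      (hAc.eq_or_eq h1.le (sup_le (hKD.le.trans hD.le) hAc.le)).resolve_left h1.ne'
    have h3 := hA.covBy_sup fun h => hAD (h.trans hKD.le)
    rw [sup_comm, h2] at h3
    exact h3.2 hKD hD.lt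
  obtain ⟨K, hK, hKD⟩ := (eq_bot_or_exists_atom_le D).resolve_left hD0
  have hne : ¬ H ≤ H' := by
    intro h
    rw [sup_eq_right.2 h] at hD
    exact hD0 ((hH'.lt_iff).1 hD.lt)
  exact hsup K hK (lt_of_le_of_ne hKD (by rintro rfl; exact hDa hK)) H' hH' (hH.covBy_sup hne)

/-- The weighted monomials are those pairing `A` with an element whose join with `A` is `G`. In a
relation containing `A` as `B'`, the terms `G' B'` and `B' C'` cancel. No partner is an atom, since
joining an atom to `A` climbs at most one cover. -/
theorem isNormalMonomial_of_not_covBy {𝒢 : Set L} (h𝒢 : ⊥ ∉ 𝒢) (m : MonomialOrder 𝒢)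
    {A B G : 𝒢} (hAG : (A : L) < G) (hc : ¬ (A : L) ⋖ G) (hA : ¬ IsAtom (A : L))
    (hsup : (A : L) ⊔ B = G)
    (hB : ∀ C : 𝒢, (C : L) ⊔ A = G →
      m.toSyn (Finsupp.single B 1) ≤ m.toSyn (Finsupp.single C 1)) :
    IsNormalMonomial m (wonderfulIdeal 𝒢) (Finsupp.single A 1 + Finsupp.single B 1) := by
  classical
  refine isNormalMonomial_of_pair h𝒢 m (fun x y => (x = A ∨ y = A) ∧ (x : L) ⊔ y = G)
    ?_ ?_ ?_ ⟨Or.inl rfl, hsup⟩ ?_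
  · rintro x y ⟨h, h'⟩
    exact ⟨h.symm, by rwa [sup_comm]⟩
  · rintro x y ⟨rfl | rfl, h⟩
    · exact hA
    · exact not_isAtom_of_sup_eq hAG hc h
  · intro G' B' C' hBC hCB hG'
    have hB' : (B' : L) ≤ G' := hG' ▸ le_sup_left
    have hC' : (C' : L) ≤ G' := hG' ▸ le_sup_right
    have hne : B' ≠ C' := by rintro rfl; exact hBC le_rfl
    simp only [sup_idem, sup_eq_left.2 hB', sup_eq_left.2 hC', hG', or_self]
    by_cases hG : (G' : L) = G
    · have hGA : G' ≠ A := by rintro rfl; exact hAG.ne hG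
      by_cases h1 : B' = A <;> by_cases h2 : C' = A <;> simp_all
    · simp [hG]
  · rintro x y ⟨rfl | rfl, h⟩
    · rw [map_add, map_add]
      exact add_le_add_right (hB y (by rwa [sup_comm])) _
    · rw [map_add, map_add, add_comm (m.toSyn (Finsupp.single x 1))]
      exact add_le_add_right (hB x h) _

end Atoms

/-! ### Relations coming from the building set -/

section BuildingSet

variable {L : Type*} [Lattice L] [BoundedOrder L] {𝒢 : Set L}

/-- Otherwise `H` has no factors, and the one-point empty product would be isomorphic to `{⊥, H}`.
-/
theorem IsBuildingSet.mem_of_isAtom (h𝒢 : IsBuildingSet 𝒢) {H : L} (hH : IsAtom H) : H ∈ 𝒢 := by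
  by_contra hn
  have hempty : IsEmpty (factors 𝒢 H) := by
    refine ⟨fun F => ?_⟩
    obtain ⟨hF, hFH⟩ := F.2.1
    rcases hH.le_iff.1 hFH with h | h
    · exact h𝒢.1 (h ▸ hF)
    · exact hn (h ▸ hF)
  obtain ⟨e, -⟩ := h𝒢.2 H
  have h := e.symm.injective (Subsingleton.elim (e.symm ⟨⊥, Set.mem_Iic.2 bot_le⟩)
    (e.symm ⟨H, Set.mem_Iic.2 le_rfl⟩))
  exact hH.1 (congrArg Subtype.val h).symm

theorem sub_mul_sub_mem_wonderfulIdeal {G A B C : 𝒢} (hA : (A : L) < G)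
    (hB : (B : L) < G) (hC : (C : L) < G) (hBA : (B : L) ⊔ A = G) (hCA : (C : L) ⊔ A = G) :
    (X B - X C) * (X G - X A) ∈ wonderfulIdeal 𝒢 := by
  have key : ∀ B : 𝒢, (B : L) < G → (B : L) ⊔ A = G →
      (X G - X B) * (X G - X A) ∈ wonderfulIdeal 𝒢 := by
    intro B hB h
    refine mul_mem_wonderfulIdeal (fun h' => ?_) (fun h' => ?_) h
    · exact hA.ne (by rw [← h, sup_eq_right.2 h'])
    · exact hB.ne (by rw [← h, sup_eq_left.2 h'])
  have := Ideal.sub_mem _ (key C hC hCA) (key B hB hBA)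
  rwa [← sub_mul, sub_sub_sub_cancel_left] at this

/-- As `D` is a coatom of `[⊥, G]`, some atom `H` also joins with it to `G`. Take the difference of
the relations for `A` and `H`, and use that `X H` is in the ideal. -/
theorem X_mul_sub_mem_wonderfulIdeal [IsAtomistic L] [IsUpperModularLattice L]
    (h𝒢 : IsBuildingSet 𝒢) {G A D : 𝒢} (hD : (D : L) ⋖ G) (hA : (A : L) < G)
    (hAD : ¬ (A : L) ≤ D) (hG : ¬ IsAtom (G : L)) :
    X A * (X G - X D) ∈ wonderfulIdeal 𝒢 := by
  obtain ⟨H, hHG, hHD⟩ := exists_atom_not_le hD.lt.not_ge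
  have hmem := h𝒢.mem_of_isAtom H.2
  have hsup : ∀ B : L, B ≤ G → ¬ B ≤ D → B ⊔ D = G := fun B hB hBD =>
    (hD.eq_or_eq le_sup_right (sup_le hB hD.le)).resolve_left fun h => hBD (h ▸ le_sup_left)
  have hHG' : (H : L) < G := lt_of_le_of_ne hHG fun h => hG (h ▸ H.2)
  have h1 := sub_mul_sub_mem_wonderfulIdeal (B := A) (C := ⟨H, hmem⟩) hD.lt hA hHG'
    (hsup A hA.le hAD) (hsup H hHG hHD)
  have h2 := Ideal.mul_mem_right (X G - X D) _ (X_mem_wonderfulIdeal (H := (⟨H, hmem⟩ : 𝒢)) H.2)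
  have := Ideal.add_mem _ h1 h2
  rwa [← add_mul, sub_add_cancel] at this

end BuildingSet

/-! ### The monomial order below a fixed element -/

section Order

variable {L : Type*} [Lattice L] [BoundedOrder L] [Fintype L] {𝒢 : Set L} {ω : Flag L}
  {r : {a : L // IsAtom a} → {a : L // IsAtom a} → Prop}
  [IsLinearOrder {a : L // IsAtom a} r] {m : MonomialOrder 𝒢}

/-- The conditions on the order of the atoms and on the monomial order. -/
structure IsCompatibleMonomialOrder (ω : Flag L)
    (r : {a : L // IsAtom a} → {a : L // IsAtom a} → Prop)
    [IsLinearOrder {a : L // IsAtom a} r] (m : MonomialOrder 𝒢) : Prop where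
  modular : ∀ M ∈ ω, IsModularElement M
  compatible : IsCompatible ω r
  lt_of_wordLT : ∀ G G' : 𝒢, WordLT r (G : L) (G' : L) →
      m.toSyn (Finsupp.single G 1) < m.toSyn (Finsupp.single G' 1)

theorem isInitialSegment_iterate (ω : Flag L) (X : L) {i j : ℕ} (h : i ≤ j) :
    IsInitialSegment ω ((d ω)^[j] X) ((d ω)^[i] X) :=
  ⟨j - i, by rw [← Function.iterate_add_apply, Nat.sub_add_cancel h]⟩

theorem IsInitialSegment.le {A G : L} (h : IsInitialSegment ω A G) : A ≤ G := by
  obtain ⟨k, rfl⟩ := h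
  exact iterate_d_le ω G k

theorem IsInitialSegment.total {A B G : L} (hA : IsInitialSegment ω A G)
    (hB : IsInitialSegment ω B G) : IsInitialSegment ω A B ∨ IsInitialSegment ω B A := by
  obtain ⟨i, rfl⟩ := hA
  obtain ⟨j, rfl⟩ := hB
  exact (le_total j i).imp (isInitialSegment_iterate ω G) (isInitialSegment_iterate ω G)

variable [IsAtomistic L]

theorem IsCompatibleMonomialOrder.lt (hm : IsCompatibleMonomialOrder ω r m) {A G : 𝒢}
    (h : IsInitialSegment ω (A : L) G) (hne : (A : L) ≠ G) :
    m.toSyn (Finsupp.single A 1) < m.toSyn (Finsupp.single G 1) :=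
  hm.lt_of_wordLT _ _ (wordLT_of_isInitialSegment hm.modular hm.compatible h hne)

theorem IsCompatibleMonomialOrder.le (hm : IsCompatibleMonomialOrder ω r m) {A G : 𝒢}
    (h : IsInitialSegment ω (A : L) G) :
    m.toSyn (Finsupp.single A 1) ≤ m.toSyn (Finsupp.single G 1) := by
  by_cases hne : (A : L) = G
  · rw [Subtype.ext hne]
  · exact (hm.lt h hne).le

theorem IsCompatibleMonomialOrder.isInitialSegment_or_lt (hm : IsCompatibleMonomialOrder ω r m)
    {A G : 𝒢} (h : (A : L) ≤ G) :
    IsInitialSegment ω (A : L) G ∨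
      m.toSyn (Finsupp.single G 1) < m.toSyn (Finsupp.single A 1) :=
  (isInitialSegment_or_wordLT hm.modular hm.compatible h).imp id (hm.lt_of_wordLT _ _)

variable [IsUpperModularLattice L]

/-- Here atoms can be partners of `D`, so the weight runs over pairs from `S` with join `G`. A
relation then takes the value `(1 - [S B']) * (1 - [S C'])`, which vanishes because two elements
outside `S` cannot be incomparable with join `G`. Discarding initial segments below `D` makes `D G`
the least pair. -/
theorem isNormalMonomial_of_covBy (h𝒢 : ⊥ ∉ 𝒢) (hm : IsCompatibleMonomialOrder ω r m) {D G : 𝒢}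
    (hD : IsInitialSegment ω (D : L) G) (hc : (D : L) ⋖ G) (hDa : ¬ IsAtom (D : L)) :
    IsNormalMonomial m (wonderfulIdeal 𝒢) (Finsupp.single D 1 + Finsupp.single G 1) := by
  classical
  have hne0 : ∀ B : 𝒢, (B : L) ≠ ⊥ := fun B h => h𝒢 (h ▸ B.2)
  let S : 𝒢 → Prop := fun x => ¬ IsAtom (x : L) ∧ ¬ (IsInitialSegment ω (x : L) G ∧ (x : L) < D)
  have hSD : S D := ⟨hDa, fun h => lt_irrefl _ h.2⟩
  have hSG : ∀ G' : 𝒢, (G' : L) = G → S G' := by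
    intro G' h
    refine ⟨fun ha => hne0 D (ha.lt_iff.1 (h ▸ hc.lt)), fun h' => ?_⟩
    exact h'.2.not_gt (h ▸ hc.lt)
  refine isNormalMonomial_of_pair h𝒢 m (fun x y => S x ∧ S y ∧ (x : L) ⊔ y = G)
    ?_ ?_ ?_ ⟨hSD, hSG G rfl, sup_eq_right.2 hc.le⟩ ?_
  · rintro x y ⟨h1, h2, h⟩
    exact ⟨h2, h1, by rwa [sup_comm]⟩
  · rintro x y ⟨h1, -⟩
    exact h1.1
  · intro G' B' C' hBC hCB hG'
    have hB' : (B' : L) ≤ G' := hG' ▸ le_sup_left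
    have hC' : (C' : L) ≤ G' := hG' ▸ le_sup_right
    simp only [sup_idem, sup_eq_left.2 hB', sup_eq_left.2 hC', hG']
    by_cases hG : (G' : L) = G
    · have hS : S B' ∨ S C' := by
        rw [hG] at hG'
        have key : ∀ x y : 𝒢, (x : L) ⊔ y = G → (y : L) < D → ¬ IsAtom (x : L) := fun x y h hy =>
          not_isAtom_of_sup_eq (hy.trans hc.lt) (fun hc' => hc'.2 hy hc.lt) h
        by_contra! hcon
        by_cases hBa : IsAtom (B' : L)
        · by_cases hCa : IsAtom (C' : L)
          · exact hDa (isAtom_of_covBy_sup hBa hCa (hG' ▸ hc) (hne0 D))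
          · exact key B' C' hG' (not_not.1 (not_and.1 hcon.2 hCa)).2 hBa
        · have hBD := (not_not.1 (not_and.1 hcon.1 hBa)).2
          by_cases hCa : IsAtom (C' : L)
          · exact key C' B' (by rwa [sup_comm]) hBD hCa
          · have hCD := (not_not.1 (not_and.1 hcon.2 hCa)).2
            exact hc.lt.not_ge (hG' ▸ sup_le hBD.le hCD.le)
      have := hSG G' hG
      by_cases h1 : S B' <;> by_cases h2 : S C' <;> simp_all
    · simp [hG]
  · rintro x y ⟨hx, hy, h⟩
    have key : ∀ z : 𝒢, S z → (z : L) ≤ G →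
        z = D ∨ m.toSyn (Finsupp.single G 1) ≤ m.toSyn (Finsupp.single z 1) := by
      intro z hz hzG
      rcases hm.isInitialSegment_or_lt hzG with hi | hi
      · have hDz : (D : L) ≤ z := by
          rcases hi.total hD with h' | h'
          · by_contra hn
            exact hz.2 ⟨hi, lt_of_le_not_ge h'.le hn⟩
          · exact h'.le
        rcases hc.eq_or_eq hDz hzG with h' | h'
        · exact Or.inl (Subtype.ext h')
        · exact Or.inr (by rw [Subtype.ext h'])
      · exact Or.inr hi.le
    have hDG := hm.le hD
    rw [map_add, map_add]
    rcases key x hx (h ▸ le_sup_left) with rfl | hx'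
    · rcases key y hy (h ▸ le_sup_right) with rfl | hy'
      · rw [sup_idem] at h
        exact absurd h hc.ne
      · exact add_le_add_right hy' _
    · rw [add_comm]
      refine add_le_add hx' ?_
      rcases key y hy (h ▸ le_sup_right) with rfl | hy'
      · exact le_rfl
      · exact hDG.trans hy'

end Order

end BuiltLattice

/-! ### The equivalence -/

open BuiltLattice MvPolynomial in
theorem mainTheorem9 {L : Type*} [Lattice L] [BoundedOrder L] [Fintype L]
    [IsAtomistic L] [IsUpperModularLattice L]
    (𝒢 : Set L) (h𝒢 : BuiltLattice.IsBuildingSet 𝒢)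
    (ω : Flag L) (hω : BuiltLattice.IsSupersolvableChain 𝒢 ω)
    (r : {a : L // IsAtom a} → {a : L // IsAtom a} → Prop)
    [IsLinearOrder {a : L // IsAtom a} r] (hr : BuiltLattice.IsCompatible ω r)
    (m : MonomialOrder 𝒢)
    (hm : ∀ G G' : 𝒢, BuiltLattice.WordLT r (G : L) (G' : L) →
      m.toSyn (Finsupp.single G 1) < m.toSyn (Finsupp.single G' 1))
    (G₁ G₂ : 𝒢) (hG₁ : ¬ IsAtom (G₁ : L)) (hG₂ : ¬ IsAtom (G₂ : L))
    (hlt : BuiltLattice.WordLT r (G₁ : L) (G₂ : L))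
    (G : L) (hG : G = (G₁ : L) ⊔ (G₂ : L)) :
    BuiltLattice.IsNormalMonomial m (BuiltLattice.wonderfulIdeal 𝒢)
        (Finsupp.single G₁ 1 + Finsupp.single G₂ 1) ↔
      (G ∉ 𝒢) ∨
      (G ∈ 𝒢 ∧ (G₂ : L) = G ∧ BuiltLattice.IsInitialSegment ω (G₁ : L) G) ∨
      (G ∈ 𝒢 ∧ ¬ (G₁ : L) ≤ (G₂ : L) ∧ ¬ (G₂ : L) ⋖ G ∧
        ∃ k : ℕ, IsGreatest {j : ℕ | (BuiltLattice.d ω)^[j] G ⊔ (G₂ : L) = G} k ∧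
          (G₁ : L) = (BuiltLattice.d ω)^[k] G) := by
  classical
  have hbot := h𝒢.1
  have hne0 : ∀ B : 𝒢, (B : L) ≠ ⊥ := fun B h => hbot (h ▸ B.2)
  have hc : IsCompatibleMonomialOrder ω r m := ⟨hω.modular, hr, hm⟩
  have hlt' := hm _ _ hlt
  by_cases hG𝒢 : G ∈ 𝒢
  swap
  · refine iff_of_true ?_ (Or.inl hG𝒢)
    -- All monomials of a quadratic relation have join in `𝒢`, so none is the given one and its
    -- coefficient alone is a valid functional.
    refine isNormalMonomial_of_pair hbot m
      (fun x y => (x = G₁ ∧ y = G₂) ∨ (x = G₂ ∧ y = G₁)) ?_ ?_ ?_ (Or.inl ⟨rfl, rfl⟩) ?_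
    · rintro x y (⟨rfl, rfl⟩ | ⟨rfl, rfl⟩) <;> simp
    · rintro x y (⟨rfl, rfl⟩ | ⟨rfl, rfl⟩) <;> assumption
    · intro G' B C _ _ hG'
      have hB' : (B : L) ≤ G' := hG' ▸ le_sup_left
      have hC' : (C : L) ≤ G' := hG' ▸ le_sup_right
      have key : ∀ x y : 𝒢, (x : L) ⊔ y = G' → ¬ ((x = G₁ ∧ y = G₂) ∨ (x = G₂ ∧ y = G₁)) := by
        rintro x y h (⟨rfl, rfl⟩ | ⟨rfl, rfl⟩)
        · exact hG𝒢 (hG ▸ h ▸ G'.2)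
        · exact hG𝒢 (hG ▸ sup_comm (x : L) y ▸ h ▸ G'.2)
      rw [if_neg (key _ _ (sup_idem _)), if_neg (key _ _ (sup_eq_left.2 hB')),
        if_neg (key _ _ (sup_eq_left.2 hC')), if_neg (key _ _ hG')]
      simp
    · rintro x y (⟨rfl, rfl⟩ | ⟨rfl, rfl⟩)
      · exact le_rfl
      · rw [add_comm]
  lift G to 𝒢 using hG𝒢
  have h1G : (G₁ : L) ≤ G := hG ▸ le_sup_left
  have h2G : (G₂ : L) ≤ G := hG ▸ le_sup_right
  have hmem : ∀ k, (d ω)^[k] (G : L) ≠ ⊥ → (d ω)^[k] (G : L) ∈ 𝒢 := by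
    intro k hk
    obtain ⟨M, hM, h⟩ := exists_iterate_d_eq ω hω.modular (G : L) k
    rw [h] at hk ⊢
    exact (hω.inf_mem M hM G G.2).resolve_right hk
  have hne : G₁ ≠ G₂ := by
    rintro rfl
    exact lt_irrefl _ hlt'
  constructor
  · intro hnormal
    by_contra hcon
    simp only [not_or, Subtype.coe_prop, not_true_eq_false, not_false_eq_true, true_and] at hcon
    obtain ⟨hcon2, hcon3⟩ := hcon
    -- The larger element is neither the join nor an initial segment of the join.
    have h2 : ¬ IsInitialSegment ω (G₂ : L) G := by
      intro hi
      have h1 : IsInitialSegment ω (G₁ : L) G :=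
        (hc.isInitialSegment_or_lt h1G).resolve_right fun h => (hlt'.trans_le (hc.le hi)).not_gt h
      rcases h1.total hi with h | h
      · exact hcon2 ⟨by rw [hG, sup_eq_right.2 h.le], h1⟩
      · exact (hc.le h).not_gt hlt'
    have h2lt : (G₂ : L) < G := lt_of_le_of_ne h2G fun h => h2 ⟨0, h⟩
    have hGlt := (hc.isInitialSegment_or_lt h2G).resolve_left h2
    have h12 : ¬ (G₁ : L) ≤ G₂ := fun h => h2lt.ne (by rw [hG, sup_eq_right.2 h])
    by_cases h21 : (G₂ : L) ≤ G₁
    · -- The smaller element is the join.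
      have hG1 : G₁ = G := Subtype.ext (by rw [hG, sup_eq_left.2 h21])
      subst hG1
      obtain ⟨-, hcov, -⟩ := exists_d_eq ω hω.modular (hne0 G₁)
      have hdb : d ω (G₁ : L) ≠ ⊥ := by
        intro h
        rw [h] at hcov
        exact hG₁ ((bot_covBy_iff).1 hcov)
      let D : 𝒢 := ⟨d ω G₁, hmem 1 hdb⟩
      -- If `G₂ ≤ D`, every later `d^k` joined with `G₂` stays below `D`, so the third condition
      -- would hold with `k = 0`.
      have hnot : ¬ (G₂ : L) ≤ D := by
        intro h
        refine hcon3 ⟨h12, ?_, 0, ⟨by simpa using h21, ?_⟩, rfl⟩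
        · intro h'
          rcases h.eq_or_lt with h3 | h3
          · exact h2 ⟨1, h3⟩
          · exact h'.2 h3 hcov.lt
        · intro k hk
          by_contra hk0
          have h3 : (d ω)^[k] (G₁ : L) ≤ D :=
            antitone_iterate_d ω (G₁ : L) (show 1 ≤ k by omega)
          exact hcov.lt.not_ge (hk.ge.trans (sup_le h3 h))
      have hmul := X_mul_sub_mem_wonderfulIdeal h𝒢 (G := G₁) (D := D) hcov h2lt hnot hG₁
      rw [mul_comm] at hmul
      exact not_isNormalMonomial_of_mul_mem m
        (degree_X_sub_X m (hc.lt ⟨1, rfl⟩ hcov.lt.ne)) m.degree_X hmul hnormal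
    have h1lt : (G₁ : L) < G :=
      lt_of_le_of_ne h1G fun h => h21 (h2G.trans h.ge)
    rcases hc.isInitialSegment_or_lt h1G with h1 | h1
    swap
    · -- Neither of the two elements is an initial segment of the join.
      have hmul := mul_mem_wonderfulIdeal h12 h21 hG.symm
      exact not_isNormalMonomial_of_mul_mem m (degree_X_sub_X' m h1) (degree_X_sub_X' m hGlt)
        hmul hnormal
    by_cases hcov : (G₂ : L) ⋖ G
    · -- The larger element is a coatom of the join.
      exact not_isNormalMonomial_of_mul_mem m m.degree_X (degree_X_sub_X' m hGlt)
        (X_mul_sub_mem_wonderfulIdeal h𝒢 hcov h1lt h12 fun ha => hne0 G₁ (ha.lt_iff.1 h1lt))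
        hnormal
    -- The smaller element is an initial segment of the join, but not the shortest one.
    obtain ⟨j, hj⟩ := h1
    have hbdd : BddAbove {i : ℕ | (d ω)^[i] (G : L) ⊔ (G₂ : L) = G} := by
      obtain ⟨n, -, h⟩ := exists_le_iterate_d ω hω.modular (bot_le : ⊥ ≤ (G : L))
      have hn : (d ω)^[n] (G : L) = ⊥ := (h.resolve_right fun h => h bot_le).symm
      refine ⟨n, fun i hi => ?_⟩
      by_contra! hni
      have hi' : (d ω)^[i] (G : L) = ⊥ :=
        le_bot_iff.1 ((antitone_iterate_d ω (G : L) hni.le).trans hn.le)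
      rw [Set.mem_ofPred_eq, hi', bot_sup_eq] at hi
      exact h2lt.ne hi
    have hjG : j ∈ {i : ℕ | (d ω)^[i] (G : L) ⊔ (G₂ : L) = G} := by
      rw [Set.mem_ofPred_eq, ← hj, hG]
    obtain ⟨k, hk, hmax⟩ := hbdd.exists_isGreatest_of_nonempty ⟨j, hjG⟩
    have hjk : j ≤ k := hmax hjG
    have hk1 : (G₁ : L) ≠ (d ω)^[k] G := fun h => hcon3 ⟨h12, hcov, k, ⟨hk, hmax⟩, h⟩
    rw [Set.mem_ofPred_eq] at hk
    have hkb : (d ω)^[k] (G : L) ≠ ⊥ := by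
      intro h
      rw [h, bot_sup_eq] at hk
      exact h2lt.ne hk
    let D : 𝒢 := ⟨(d ω)^[k] G, hmem k hkb⟩
    have hD1 : IsInitialSegment ω (D : L) G₁ := hj ▸ isInitialSegment_iterate ω (G : L) hjk
    have hmul := sub_mul_sub_mem_wonderfulIdeal (B := G₁) (C := D) h2lt h1lt
      (hD1.le.trans_lt h1lt) hG.symm hk
    exact not_isNormalMonomial_of_mul_mem m (degree_X_sub_X m (hc.lt hD1 (Ne.symm hk1)))
      (degree_X_sub_X' m hGlt) hmul hnormal
  · rintro (h | ⟨-, h2, h1⟩ | ⟨-, h12, hcov, k, ⟨hk, hmax⟩, hk1⟩)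
    · exact absurd G.2 h
    · obtain rfl : G₂ = G := Subtype.ext h2
      have h1lt : (G₁ : L) < G₂ := lt_of_le_of_ne h1G fun h => hne (Subtype.ext h)
      by_cases hcov : (G₁ : L) ⋖ G₂
      · exact isNormalMonomial_of_covBy hbot hc h1 hcov hG₁
      -- A partner `C` that is an initial segment is comparable with `G₁`, hence equal to the join;
      -- any other partner exceeds it.
      · refine isNormalMonomial_of_not_covBy hbot m h1lt hcov hG₁ hG.symm fun C hC => ?_
        rcases hc.isInitialSegment_or_lt (hC ▸ le_sup_left : (C : L) ≤ G₂) with hi | hi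
        · rcases hi.total h1 with h | h
          · exact absurd (by rw [← hC, sup_eq_right.2 h.le]) h1lt.ne
          · rw [sup_eq_left.2 h.le] at hC
            rw [Subtype.ext hC]
        · exact hi.le
    · have h2lt : (G₂ : L) < G := by
        refine lt_of_le_of_ne h2G fun h => h12 (h1G.trans h.ge)
      -- Now `G₂` is the fixed factor. Its partners among initial segments are `d^i(G)` with `i ≤
      -- k`, so `G₁ = d^k(G)` is the least.
      rw [add_comm]
      refine isNormalMonomial_of_not_covBy hbot m h2lt hcov hG₂ (by rw [hG, sup_comm])
        fun C hC => ?_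
      rcases hc.isInitialSegment_or_lt (hC ▸ le_sup_left : (C : L) ≤ G) with ⟨i, hi⟩ | hi
      · refine hc.le ?_
        rw [hk1, hi]
        exact isInitialSegment_iterate ω (G : L) (hmax (by rw [Set.mem_ofPred_eq, ← hi]; exact hC))
      · exact (hc.le ⟨k, hk1⟩).trans hi.le
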